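/- **Setting.** Consider the quadratic program $\min_x \tfrac12 x^THx+c^Tx$ subject to $Ax\ge b$, with $H\in\mathbb R^{n\times n}$, $A\in\mathbb R^{m\times n}$, $c\in\mathbb R^n$, $b\in\mathbb R^m$. Write $z=(x,\lambda,s)\in\mathbb R^{n+2m}$, $\Lambda=\mathrm{diag}(\lambda)$, $S=\mathrm{diag}(s)$, $e=(1,\dots,1)^T$, and $$F_\mu(z)=\begin{pmatrix}Hx+c-A^T\lambda\\ Ax-s-b\\ \Lambda Se-\mu e\end{pmatrix},\qquad F'(z)=\begin{pmatrix}H&-A^T&0\\A&0&-I\\0&S&\Lambda\end{pmatrix}.$$ All norms are 2-norms and $\mathcal B(z^*,\delta)=\{z:\|z-z^*\|<\delta\}$. Let $z^*=(x^*,\lambda^*,s^*)$ satisfy the second-order sufficient conditions and strict complementarity: $Hx^*+c-A^T\lambda^*=0$, $Ax^*-s^*-b=0$, $s^*\ge0$, $\lambda^*\ge0$, $s_i^*\lambda_i^*=0$ for all $i$; $p^THp>0$ for every $p\ne0$ with $(Ap)_i=0$ for all $i$ with $s_i^*=0<\lambda_i^*$; and $s_i^*+\lambda_i^*>0$ for all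 $i$. Let $\delta,M>0$ be such that $F'(z)$ is nonsingular with $\|F'(z)^{-1}\|\le M$ for all $z\in\mathcal B(z^*,\delta)$, and put $C_3=\sup_{z\in\mathcal B(z^*,\delta)}\|F'(z)^{-1}\,\partial F_\mu(z)/\partial\mu\|$, where $\partial F_\mu/\partial\mu=(0,0,-e)$. Let $\hat\mu>0$ be such that there is a Lipschitz continuous barrier trajectory $\mu\mapsto z^\mu\in\mathcal B(z^*,\delta)$ with $F_\mu(z^\mu)=0$ for $0<\mu\le\hat\mu$. For $C>0$, $0\le r<m$, $0<\mu\le\hat\mu$, $0<\sigma<1$, $0<\sigma^+\le1$, let $z\in\mathcal B(z^*,\delta)$ satisfy $\|F_\mu(z)\|\le C\mu$. Let $\Delta\hat z=(\Delta\hat x,\Delta\hat\lambda,\Delta\hat s)$ solve $F'(z)\Delta\hat z=-F_{\mu^+}(z)$ with $\mu^+=\sigma\mu$, put $z^+=z+\Delta\hat z$, and suppose $z^+\in\mathcal B(z^*,\delta)$. Put $q_i=\sqrt{(\Delta\hat\lambda_i)^2+(\Delta\hat s_i)^2}$, let $q_{(1)}\ge\dots\ge q_{(m)}$ be these numbers in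 descending order, and let $\mathcal U_r$ be a set of indices of $r$ largest of the $q_i$ (ties broken in any way). With $$U_*=\sum_{i\in\mathcal U_r}e_{n+m+i}\big(\Delta\hat s_i\,e_{n+i}+\Delta\hat\lambda_i\,e_{n+m+i}\big)^T,\qquad B^+=F'(z)+U_*,\qquad \mu^{++}=\sigma^+\mu^+,$$ let $\Delta\hat z^+$ and $\Delta z^+$ be the Newton and modified Newton steps, $F'(z^+)\Delta\hat z^+=-F_{\mu^{++}}(z^+)$ and $B^+\Delta z^+=-F_{\mu^{++}}(z^+)$. **Theorem.** If the rows $A_i$ with $s_i^*=0$ are linearly independent, then such $\delta,M$ exist. For every such $\delta,M$ such $\hat\mu$ and $z^\mu$ exist, and for every such $\delta,M,\hat\mu,z^\mu$, every $0\le r<m$ and every $C>0$: 1. There is a constant $C^{(r+1)}>0$ such that $q_{(r+1)}\le C^{(r+1)}\mu$ for all $\mu,\sigma,z$ as above. 2. There is $K>0$ such that for every $C^{(r+1)}>0$ there is $0<\bar\mu\le\hat\mu$ such that, for all $0<\mu\le\bar\mu$ and all $\sigma,\sigma^+,z,\mathcal U_r$ as above with $q_{(r+1)}\le C^{(r+1)}\mu$,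 we have $MC^{(r+1)}\mu<1$, $B^+$ is nonsingular, and $$\|\Delta\hat z^+-\Delta z^+\|\le\frac{MC^{(r+1)}}{1-MC^{(r+1)}\mu}\Big(C_3(1-\sigma^+)\sigma\mu^2+K\mu^3\Big).$$ 3. There are $K'>0$ and $0<\bar\mu\le\hat\mu$ such that, for all $0<\mu\le\bar\mu$ and all $\sigma,\sigma^+,z,\mathcal U_r$ as above, $\|\Delta\hat z^+-\Delta z^+\|\le K'\mu^2$, and $\|\Delta\hat z^+-\Delta z^+\|\le K'\mu^3$ if $\sigma^+=1$. -/

import Mathlib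

open scoped Matrix Matrix.Norms.L2Operator

noncomputable section

namespace QPBarrier

/-- Index set of a primal-dual vector `z = (x, lam, s)` in `ℝ^(n+2m)`:
the blocks are `x`, `lam` and `s`, in this order. -/
abbrev Idx (n m : ℕ) : Type := Fin n ⊕ (Fin m ⊕ Fin m)

/-- The space `ℝ^(n+2m)` of triples `(x, lam, s)`, with the Euclidean norm. -/
abbrev PDVec (n m : ℕ) : Type := EuclideanSpace ℝ (Idx n m)

/-- The coordinate of index `j` of the `x`-block. -/
abbrev ix {n m : ℕ} (j : Fin n) : Idx n m := Sum.inl j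
/-- The coordinate of index `i` of the `lam`-block. -/
abbrev il {n m : ℕ} (i : Fin m) : Idx n m := Sum.inr (Sum.inl i)
/-- The coordinate of index `i` of the `s`-block. -/
abbrev is {n m : ℕ} (i : Fin m) : Idx n m := Sum.inr (Sum.inr i)

/-- The primal part `x` of `z = (x, lam, s)`. -/
def primal {n m : ℕ} (z : PDVec n m) : Fin n → ℝ := fun j => z (ix j)
/-- The multipliers `lam` of `z = (x, lam, s)`. -/
def mult {n m : ℕ} (z : PDVec n m) : Fin m → ℝ := fun i => z (il i)
/-- The slack variables `s` of `z = (x, lam, s)`. -/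
def slack {n m : ℕ} (z : PDVec n m) : Fin m → ℝ := fun i => z (is i)

/-- Data of the quadratic program: minimize `½ xᵀ H x + cᵀ x` subject to `A x ≥ b`. -/
structure QP (n m : ℕ) where
  H : Matrix (Fin n) (Fin n) ℝ
  c : Fin n → ℝ
  A : Matrix (Fin m) (Fin n) ℝ
  b : Fin m → ℝ

variable {n m : ℕ}

/-- The map `F_μ(z) = (H x + c - Aᵀ lam, A x - s - b, Λ S e - μ e)`. -/
def QP.residual (P : QP n m) (μ : ℝ) (z : PDVec n m) : PDVec n m :=
  WithLp.toLp 2 (Sum.elim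
    (P.H *ᵥ primal z + P.c - P.Aᵀ *ᵥ mult z)
    (Sum.elim (P.A *ᵥ primal z - slack z - P.b) (fun i => mult z i * slack z i - μ)))

/-- The Jacobian `F'(z) = [[H, -Aᵀ, 0], [A, 0, -I], [0, S, Λ]]`. -/
def QP.jac (P : QP n m) (z : PDVec n m) : Matrix (Idx n m) (Idx n m) ℝ :=
  Matrix.fromBlocks
    P.H (Matrix.fromCols (-P.Aᵀ) 0)
    (Matrix.fromRows P.A 0)
    (Matrix.fromBlocks 0 (-1) (Matrix.diagonal (slack z)) (Matrix.diagonal (mult z)))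

/-- The partial derivative `∂F_μ(z)/∂μ = (0, 0, -e)`, which depends neither on `μ` nor on `z`. -/
def residualDeriv (n m : ℕ) : PDVec n m :=
  WithLp.toLp 2 (Sum.elim 0 (Sum.elim 0 (fun _ => -1)))

theorem QP.hasDerivAt_residual (P : QP n m) (z : PDVec n m) (μ : ℝ) :
    HasDerivAt (fun ν => P.residual ν z) (residualDeriv n m) μ := by
  have h : (fun ν : ℝ => P.residual ν z) =
      fun ν : ℝ => P.residual 0 z + ν • residualDeriv n m := by
    funext ν
    ext k
    rcases k with j | i | i <;> simp [QP.residual, residualDeriv, sub_eq_add_neg]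
  rw [h]
  simpa using ((hasDerivAt_id μ).smul_const (residualDeriv n m)).const_add (P.residual 0 z)

/-- `z = (x, lam, s)` satisfies the second-order sufficient optimality conditions and strict
complementarity.  The curvature condition says that `H` is positive definite on the null space of
the rows of `A` that belong to the active constraints with strictly positive multiplier. -/
structure QP.IsStrictMin (P : QP n m) (z : PDVec n m) : Prop where
  stationarity : P.H *ᵥ primal z + P.c - P.Aᵀ *ᵥ mult z = 0
  feasibility : P.A *ᵥ primal z - slack z - P.b = 0
  slack_nonneg : ∀ i, 0 ≤ slack z i
  mult_nonneg : ∀ i, 0 ≤ mult z i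
  complementarity : ∀ i, slack z i * mult z i = 0
  posDef : ∀ p : Fin n → ℝ, p ≠ 0 →
    (∀ i, slack z i = 0 → 0 < mult z i → (P.A *ᵥ p) i = 0) → 0 < p ⬝ᵥ (P.H *ᵥ p)
  strict : ∀ i, 0 < slack z i + mult z i

/-- The rows of `A` that belong to the constraints active at `z` are linearly independent. -/
def QP.LICQ (P : QP n m) (z : PDVec n m) : Prop :=
  LinearIndependent ℝ (fun i : {i : Fin m // slack z i = 0} => P.A (i : Fin m))

/-- On the open ball of radius `δ` around `zs` the Jacobian is nonsingular and the spectral norm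
of its inverse is at most `M`. -/
def QP.IsJacNhd (P : QP n m) (zs : PDVec n m) (δ M : ℝ) : Prop :=
  0 < δ ∧ 0 < M ∧ ∀ z ∈ Metric.ball zs δ, IsUnit (P.jac z) ∧ ‖(P.jac z)⁻¹‖ ≤ M

/-- The constant `C₃`: the supremum over the ball of `‖F'(z)⁻¹ ∂F_μ(z)/∂μ‖`. -/
def QP.trajConst (P : QP n m) (zs : PDVec n m) (δ : ℝ) : ℝ :=
  ⨆ z : Metric.ball zs δ,
    ‖WithLp.toLp 2 ((P.jac (z : PDVec n m))⁻¹ *ᵥ (residualDeriv n m).ofLp)‖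

/-- `μ ↦ zμ μ` is a Lipschitz continuous barrier trajectory in the ball, for `0 < μ ≤ μhat`. -/
def QP.IsTrajectory (P : QP n m) (zs : PDVec n m) (δ μhat : ℝ) (zμ : ℝ → PDVec n m) : Prop :=
  0 < μhat ∧ (∃ L, LipschitzOnWith L zμ (Set.Ioc 0 μhat)) ∧
    ∀ μ ∈ Set.Ioc 0 μhat, zμ μ ∈ Metric.ball zs δ ∧ P.residual μ (zμ μ) = 0

/-- The quantities `sqrt (Δlam_i ^ 2 + Δs_i ^ 2)`. -/
def pairSize (dz : PDVec n m) (i : Fin m) : ℝ := √(mult dz i ^ 2 + slack dz i ^ 2)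

/-- The entry with (zero-based) position `k` of the list of the quantities `pairSize dz i`
arranged in descending order; position `r` holds the `(r+1)`-st largest of them. -/
def orderedPairSize (dz : PDVec n m) (k : Fin m) : ℝ :=
  pairSize dz (Tuple.sort (fun i => -pairSize dz i) k)

/-- `T` is a set of indices of the `r` largest of the quantities `pairSize dz i`
(ties are broken in any way). -/
def IsLargestSet (dz : PDVec n m) (r : ℕ) (T : Finset (Fin m)) : Prop :=
  T.card = r ∧ ∀ i ∈ T, ∀ j ∉ T, pairSize dz j ≤ pairSize dz i

/-- The update matrix `U_* = ∑_{i ∈ T} e_{n+m+i} (Δs_i e_{n+i} + Δlam_i e_{n+m+i})ᵀ`. -/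
def updateMatrix (dz : PDVec n m) (T : Finset (Fin m)) : Matrix (Idx n m) (Idx n m) ℝ :=
  ∑ i ∈ T, Matrix.vecMulVec (Pi.single (is i) 1)
    (slack dz i • Pi.single (il i) 1 + mult dz i • Pi.single (is i) 1)

/-- `dz` solves the Newton equation `F'(z) dz = -F_μ(z)`. -/
def QP.IsNewtonStep (P : QP n m) (μ : ℝ) (z dz : PDVec n m) : Prop :=
  P.jac z *ᵥ dz.ofLp = -(P.residual μ z).ofLp

/-- The first iteration: `z` is in the ball with `‖F_μ(z)‖ ≤ C μ`, `dz` is the Newton step at `z`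
for the barrier parameter `σ μ`, `z + dz` is in the ball, and `T` is the index set that defines
the rank-`r` update. -/
structure QP.IsFirstStep (P : QP n m) (zs : PDVec n m) (δ C : ℝ) (r : ℕ) (μ σ : ℝ)
    (z dz : PDVec n m) (T : Finset (Fin m)) : Prop where
  mem_ball : z ∈ Metric.ball zs δ
  residual_le : ‖P.residual μ z‖ ≤ C * μ
  newton : P.IsNewtonStep (σ * μ) z dz
  next_mem_ball : z + dz ∈ Metric.ball zs δ
  largest : IsLargestSet dz r T

/-- The modified Jacobian `B⁺ = F'(z) + U_*`. -/
def QP.modJac (P : QP n m) (z dz : PDVec n m) (T : Finset (Fin m)) :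
    Matrix (Idx n m) (Idx n m) ℝ :=
  P.jac z + updateMatrix dz T

/-- `dzm` solves the modified Newton equation `B⁺ dzm = -F_μ(z + dz)` at `z + dz`. -/
def QP.IsModNewtonStep (P : QP n m) (μ : ℝ) (z dz : PDVec n m) (T : Finset (Fin m))
    (dzm : PDVec n m) : Prop :=
  P.modJac z dz T *ᵥ dzm.ofLp = -(P.residual μ (z + dz)).ofLp

end QPBarrier

end

namespace QPBarrier

open scoped Topology
open Filter

variable {n m : ℕ}

/-! `F_μ` is affine apart from the products `λ_i s_i`, so its expansions are exact. A Newton step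
for `σμ` leaves only the products `Δλ_i Δs_i`, of norm at most `‖Δẑ‖²`, and `F'(z⁺)` differs from
`F'(z)` only in the complementarity rows. `U_*` restores `r` of these rows exactly; by
Cauchy–Schwarz the remaining ones form a perturbation of norm at most `q = q_(r+1)`. Hence the two
steps at `z⁺` differ by at most `Mq/(1 - Mq) * ‖Δẑ⁺‖`
(`QP.IsFirstStep.norm_newton_sub_modNewton_le`).

Since `‖Δẑ‖ = O(μ)`, also `q = O(μ)`, while `‖Δẑ⁺‖ ≤ C₃(1-σ⁺)σμ + O(μ²)`
(`QP.IsFirstStep.norm_nextNewton_le`). Multiplying gives the error bounds.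

The existence claims rest on nonsingularity of `F'(z*)`: continuity of inversion yields the ball,
and the inverse function theorem yields the trajectory. -/

/-! ### Norm estimates for the pairs `(λ_i, s_i)`. -/

theorem PDVec.norm_sq_eq (v : PDVec n m) :
    ‖v‖ ^ 2 = ∑ j, primal v j ^ 2 + (∑ i, mult v i ^ 2 + ∑ i, slack v i ^ 2) := by
  rw [EuclideanSpace.real_norm_sq_eq, Fintype.sum_sum_type, Fintype.sum_sum_type]
  rfl

/-- The vector `(0, 0, w)`. -/
def slackEmb (w : Fin m → ℝ) : PDVec n m :=
  WithLp.toLp 2 (Sum.elim 0 (Sum.elim 0 w))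

theorem norm_sq_slackEmb (w : Fin m → ℝ) : ‖(slackEmb w : PDVec n m)‖ ^ 2 = ∑ i, w i ^ 2 := by
  rw [PDVec.norm_sq_eq]
  simp [slackEmb, primal, mult, slack]

theorem sum_pairSize_sq_le (v : PDVec n m) : ∑ i, pairSize v i ^ 2 ≤ ‖v‖ ^ 2 := by
  have h : ∀ i, pairSize v i ^ 2 = mult v i ^ 2 + slack v i ^ 2 := fun i =>
    Real.sq_sqrt (by positivity)
  simp only [h, Finset.sum_add_distrib, PDVec.norm_sq_eq]
  have : 0 ≤ ∑ j, primal v j ^ 2 := by positivity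
  linarith

theorem pairSize_le_norm (v : PDVec n m) (i : Fin m) : pairSize v i ≤ ‖v‖ := by
  refine (sq_le_sq₀ (Real.sqrt_nonneg _) (norm_nonneg v)).1 ?_
  exact (Finset.single_le_sum (f := fun i => pairSize v i ^ 2) (fun _ _ => sq_nonneg _)
    (Finset.mem_univ i)).trans (sum_pairSize_sq_le v)

/-- Diagonal scalings of the pairs `(mult v, slack v)` bounded by `q` have norm at most `q`. -/
theorem norm_slackEmb_le (v : PDVec n m) (w : Fin m → ℝ) {q : ℝ} (hq : 0 ≤ q)
    (h : ∀ i, |w i| ≤ q * pairSize v i) : ‖(slackEmb w : PDVec n m)‖ ≤ q * ‖v‖ := by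
  refine (sq_le_sq₀ (norm_nonneg _) (by positivity)).1 ?_
  rw [norm_sq_slackEmb]
  calc ∑ i, w i ^ 2 ≤ ∑ i, q ^ 2 * pairSize v i ^ 2 := by
        refine Finset.sum_le_sum fun i _ => ?_
        rw [← mul_pow, ← sq_abs (w i)]
        exact pow_le_pow_left₀ (abs_nonneg _) (h i) 2
    _ = q ^ 2 * ∑ i, pairSize v i ^ 2 := by rw [Finset.mul_sum]
    _ ≤ q ^ 2 * ‖v‖ ^ 2 := by gcongr; exact sum_pairSize_sq_le v
    _ = (q * ‖v‖) ^ 2 := by ring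

/-- Cauchy–Schwarz in the plane of the `i`-th pair, with the coordinates of one vector swapped. -/
theorem abs_cross_le (u v : PDVec n m) (i : Fin m) :
    |slack u i * mult v i + mult u i * slack v i| ≤ pairSize u i * pairSize v i := by
  unfold pairSize
  rw [← Real.sqrt_mul (by positivity)]
  refine Real.abs_le_sqrt ?_
  nlinarith [sq_nonneg (slack u i * slack v i - mult u i * mult v i)]

theorem abs_mult_mul_slack_le (v : PDVec n m) (i : Fin m) :
    |mult v i * slack v i| ≤ ‖v‖ * pairSize v i := by
  have h := abs_cross_le v v i
  have h2 : slack v i * mult v i + mult v i * slack v i = 2 * (mult v i * slack v i) := by ring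
  rw [h2, abs_mul, abs_two] at h
  have h3 : pairSize v i * pairSize v i ≤ ‖v‖ * pairSize v i :=
    mul_le_mul_of_nonneg_right (pairSize_le_norm v i) (Real.sqrt_nonneg _)
  linarith [abs_nonneg (mult v i * slack v i)]

/-! ### Exact expansions of the Jacobian and the residual. -/

theorem QP.jac_mulVec (P : QP n m) (z v : PDVec n m) :
    P.jac z *ᵥ v.ofLp = Sum.elim (P.H *ᵥ primal v - P.Aᵀ *ᵥ mult v)
      (Sum.elim (P.A *ᵥ primal v - slack v)
        (fun i => slack z i * mult v i + mult z i * slack v i)) := by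
  have hv : v.ofLp = Sum.elim (primal v) (Sum.elim (mult v) (slack v)) := by
    funext k
    rcases k with j | i | i <;> rfl
  rw [hv, QP.jac]
  funext k
  rcases k with j | i | i <;>
    simp [Matrix.fromBlocks_mulVec, Matrix.mulVec_diagonal, Matrix.neg_mulVec,
      Matrix.fromCols_mulVec, Matrix.fromRows_mulVec, sub_eq_add_neg, Function.comp_def]

theorem updateMatrix_mulVec (dz v : PDVec n m) (T : Finset (Fin m)) :
    updateMatrix dz T *ᵥ v.ofLp = (slackEmb (fun i =>
      if i ∈ T then slack dz i * mult v i + mult dz i * slack v i else 0) : PDVec n m).ofLp := by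
  classical
  funext k
  rw [updateMatrix, Matrix.sum_mulVec, Finset.sum_apply]
  rcases k with j | i | i <;>
    simp [Matrix.vecMulVec_mulVec, slackEmb, Pi.single_apply, add_dotProduct, mult, slack]

/-- The Jacobian is affine in `z` and only its last block row varies; the update reproduces this
change exactly in the rows of `T`. -/
theorem QP.jac_add_mulVec (P : QP n m) (z dz v : PDVec n m) (T : Finset (Fin m)) :
    P.jac (z + dz) *ᵥ v.ofLp = P.modJac z dz T *ᵥ v.ofLp + (slackEmb (fun i =>
      if i ∈ T then 0 else slack dz i * mult v i + mult dz i * slack v i) : PDVec n m).ofLp := by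
  rw [QP.modJac, Matrix.add_mulVec, updateMatrix_mulVec, P.jac_mulVec, P.jac_mulVec]
  funext k
  rcases k with j | i | i
  · simp [slackEmb]
  · simp [slackEmb]
  · by_cases h : i ∈ T <;> simp [slackEmb, h, mult, slack] <;> ring

theorem QP.residual_add (P : QP n m) (μ : ℝ) (z d : PDVec n m) :
    P.residual μ (z + d) = P.residual μ z + WithLp.toLp 2 (P.jac z *ᵥ d.ofLp) +
      slackEmb (fun i => mult d i * slack d i) := by
  have h1 : primal (z + d) = primal z + primal d := rfl
  have h2 : mult (z + d) = mult z + mult d := rfl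
  have h3 : slack (z + d) = slack z + slack d := rfl
  rw [P.jac_mulVec]
  ext k
  rcases k with j | i | i <;>
    simp [QP.residual, slackEmb, h1, h2, h3, Matrix.mulVec_add] <;> ring

theorem QP.residual_eq_add_smul (P : QP n m) (μ ν : ℝ) (z : PDVec n m) :
    P.residual μ z = P.residual ν z + (μ - ν) • residualDeriv n m := by
  ext k
  rcases k with j | i | i <;> simp [QP.residual, residualDeriv]

theorem norm_residualDeriv_le : ‖residualDeriv n m‖ ≤ √m := by
  refine Real.le_sqrt_of_sq_le ?_
  rw [PDVec.norm_sq_eq]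
  simp [residualDeriv, primal, mult, slack]

/-! ### Ordered pair sizes and bounds through the inverse. -/

/-- Pigeonhole: otherwise the `r + 1` indices of `insert j T` would all have pair size above the one
at zero-based position `r`, hence occupy positions below `r`, of which there are only `r`. -/
theorem pairSize_le_orderedPairSize {dz : PDVec n m} {r : ℕ} (hr : r < m) {T : Finset (Fin m)}
    (hT : IsLargestSet dz r T) {j : Fin m} (hj : j ∉ T) :
    pairSize dz j ≤ orderedPairSize dz ⟨r, hr⟩ := by
  by_contra! hlt
  set e := Tuple.sort (fun i => -pairSize dz i)
  have hmono : Monotone ((fun i => -pairSize dz i) ∘ e) := Tuple.monotone_sort _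
  have hpos : ∀ i ∈ insert j T, e.symm i ∈ Finset.Iio (⟨r, hr⟩ : Fin m) := by
    intro i hi
    rw [Finset.mem_Iio]
    by_contra! hle
    have h1 := hmono hle
    simp only [Function.comp_apply, Equiv.apply_symm_apply, neg_le_neg_iff] at h1
    have h2 : pairSize dz j ≤ pairSize dz i := by
      rcases Finset.mem_insert.1 hi with rfl | hi
      · exact le_rfl
      · exact hT.2 i hi j hj
    exact absurd (h2.trans h1) (not_le.2 hlt)
  have hcard := Finset.card_le_card_of_injOn e.symm hpos e.symm.injective.injOn
  rw [Finset.card_insert_of_notMem hj, hT.1, Fin.card_Iio] at hcard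
  exact absurd hcard (by simp)

theorem norm_mulVec_le {k : Type*} [Fintype k] [DecidableEq k] {B : Matrix k k ℝ} {M : ℝ}
    (hB : ‖B‖ ≤ M) (v : EuclideanSpace ℝ k) : ‖WithLp.toLp 2 (B *ᵥ v.ofLp)‖ ≤ M * ‖v‖ :=
  (Matrix.l2_opNorm_mulVec B v).trans (by gcongr)

theorem norm_le_of_mulVec_eq {k : Type*} [Fintype k] [DecidableEq k] {B : Matrix k k ℝ} {M : ℝ}
    (hu : IsUnit B) (hB : ‖B⁻¹‖ ≤ M) {v w : EuclideanSpace ℝ k} (h : B *ᵥ v.ofLp = w.ofLp) :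
    ‖v‖ ≤ M * ‖w‖ := by
  have h1 : B⁻¹ *ᵥ w.ofLp = v.ofLp := by
    rw [← h, Matrix.mulVec_mulVec, Matrix.nonsing_inv_mul _ ((Matrix.isUnit_iff_isUnit_det B).1 hu),
      Matrix.one_mulVec]
  have h2 := norm_mulVec_le hB w
  rwa [h1] at h2

/-! ### Newton and modified Newton steps in the ball. -/

section Estimates

variable {P : QP n m} {zs : PDVec n m} {δ M : ℝ}

theorem QP.IsJacNhd.le_trajConst (h : P.IsJacNhd zs δ M) {z : PDVec n m}
    (hz : z ∈ Metric.ball zs δ) :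
    ‖WithLp.toLp 2 ((P.jac z)⁻¹ *ᵥ (residualDeriv n m).ofLp)‖ ≤ P.trajConst zs δ := by
  refine le_ciSup (f := fun z : Metric.ball zs δ =>
    ‖WithLp.toLp 2 ((P.jac (z : PDVec n m))⁻¹ *ᵥ (residualDeriv n m).ofLp)‖) ?_ ⟨z, hz⟩
  -- A real supremum dominates its terms only if the family is bounded; the bound `M` on the
  -- inverses provides this.
  refine ⟨M * ‖residualDeriv n m‖, ?_⟩
  rintro _ ⟨y, rfl⟩
  exact norm_mulVec_le (h.2.2 y y.2).2 _

theorem QP.trajConst_nonneg (P : QP n m) (zs : PDVec n m) (δ : ℝ) : 0 ≤ P.trajConst zs δ :=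
  Real.iSup_nonneg fun _ => norm_nonneg _

/-- Lowering the parameter from `μ` to `σμ` changes the residual by at most `√m * μ`, on top of the
`C * μ` already present. -/
theorem QP.IsFirstStep.norm_le (h : P.IsJacNhd zs δ M) {C μ σ : ℝ} {r : ℕ} {z dz : PDVec n m}
    {T : Finset (Fin m)} (hμ : 0 < μ) (hσ : σ ∈ Set.Ioo (0 : ℝ) 1)
    (hs : P.IsFirstStep zs δ C r μ σ z dz T) : ‖dz‖ ≤ M * (C + √m) * μ := by
  have hJ := h.2.2 z hs.mem_ball
  have h1 : ‖dz‖ ≤ M * ‖-P.residual (σ * μ) z‖ := norm_le_of_mulVec_eq hJ.1 hJ.2 hs.newton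
  have h2 : ‖P.residual (σ * μ) z‖ ≤ (C + √m) * μ := by
    rw [P.residual_eq_add_smul (σ * μ) μ z]
    refine (norm_add_le _ _).trans ?_
    rw [norm_smul, Real.norm_eq_abs, add_mul, mul_comm √(m : ℝ)]
    refine add_le_add hs.residual_le (mul_le_mul ?_ norm_residualDeriv_le (norm_nonneg _) hμ.le)
    rw [abs_le]
    constructor <;> nlinarith [hσ.1, hσ.2, mul_pos hσ.1 hμ]
  rw [norm_neg] at h1
  calc ‖dz‖ ≤ M * ‖P.residual (σ * μ) z‖ := h1
    _ ≤ M * ((C + √m) * μ) := mul_le_mul_of_nonneg_left h2 h.2.1.le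
    _ = _ := by ring

/-- After a Newton step the residual consists of the second-order terms only. -/
theorem QP.IsNewtonStep.residual_add {μ : ℝ} {z dz : PDVec n m} (h : P.IsNewtonStep μ z dz) :
    P.residual μ (z + dz) = slackEmb (fun i => mult dz i * slack dz i) := by
  rw [P.residual_add, show P.jac z *ᵥ dz.ofLp = _ from h]
  simp

theorem QP.IsNewtonStep.norm_residual_add_le {μ : ℝ} {z dz : PDVec n m}
    (h : P.IsNewtonStep μ z dz) : ‖P.residual μ (z + dz)‖ ≤ ‖dz‖ ^ 2 := by
  rw [h.residual_add, sq]
  exact norm_slackEmb_le dz _ (norm_nonneg _) (abs_mult_mul_slack_le dz)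

/-- The right-hand side splits into the parameter change `(1 - σ')σμ` times `∂F/∂μ`, which yields
`C₃`, and the second-order residual left by the first step. -/
theorem QP.IsFirstStep.norm_nextNewton_le (h : P.IsJacNhd zs δ M) {C μ σ σ' : ℝ} {r : ℕ}
    {z dz dzN : PDVec n m} {T : Finset (Fin m)} (hμ : 0 < μ) (hσ : σ ∈ Set.Ioo (0 : ℝ) 1)
    (hσ' : σ' ∈ Set.Ioc (0 : ℝ) 1) (hs : P.IsFirstStep zs δ C r μ σ z dz T)
    (hN : P.IsNewtonStep (σ' * (σ * μ)) (z + dz) dzN) :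
    ‖dzN‖ ≤ P.trajConst zs δ * (1 - σ') * σ * μ + M * (M * (C + √m)) ^ 2 * μ ^ 2 := by
  have hJ := h.2.2 _ hs.next_mem_ball
  have hdet := (Matrix.isUnit_iff_isUnit_det _).1 hJ.1
  set R := P.residual (σ * μ) (z + dz) with hR
  have h0 : dzN = (σ * μ * (1 - σ')) •
        WithLp.toLp 2 ((P.jac (z + dz))⁻¹ *ᵥ (residualDeriv n m).ofLp) -
      WithLp.toLp 2 ((P.jac (z + dz))⁻¹ *ᵥ R.ofLp) := by
    have h1 : dzN.ofLp = (P.jac (z + dz))⁻¹ *ᵥ (P.jac (z + dz) *ᵥ dzN.ofLp) := by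
      rw [Matrix.mulVec_mulVec, Matrix.nonsing_inv_mul _ hdet, Matrix.one_mulVec]
    rw [show P.jac (z + dz) *ᵥ dzN.ofLp = _ from hN,
      P.residual_eq_add_smul _ (σ * μ), ← hR] at h1
    apply WithLp.ofLp_injective 2
    rw [h1]
    simp only [WithLp.ofLp_add, WithLp.ofLp_smul, WithLp.ofLp_sub, Matrix.mulVec_neg,
      Matrix.mulVec_add, Matrix.mulVec_smul]
    module
  have hc : 0 ≤ σ * μ * (1 - σ') :=
    mul_nonneg (mul_pos hσ.1 hμ).le (sub_nonneg.2 hσ'.2)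
  have hd := hs.norm_le h hμ hσ
  calc ‖dzN‖ ≤ ‖(σ * μ * (1 - σ')) •
        WithLp.toLp 2 ((P.jac (z + dz))⁻¹ *ᵥ (residualDeriv n m).ofLp)‖ +
          ‖WithLp.toLp 2 ((P.jac (z + dz))⁻¹ *ᵥ R.ofLp)‖ := by
        conv_lhs => rw [h0]
        exact norm_sub_le _ _
    _ ≤ σ * μ * (1 - σ') * P.trajConst zs δ + M * ‖R‖ := by
        rw [norm_smul, Real.norm_of_nonneg hc]
        exact add_le_add (mul_le_mul_of_nonneg_left (h.le_trajConst hs.next_mem_ball) hc)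
          (norm_mulVec_le hJ.2 R)
    _ ≤ σ * μ * (1 - σ') * P.trajConst zs δ + M * (M * (C + √m) * μ) ^ 2 := by
        have hM := h.2.1.le
        have := hs.newton.norm_residual_add_le.trans (pow_le_pow_left₀ (norm_nonneg _) hd 2)
        gcongr
    _ = _ := by ring

/-- The rows left out of the update perturb `F'(z⁺)` by at most `M q` relative to itself. -/
theorem QP.IsFirstStep.norm_le_of_jac_eq (h : P.IsJacNhd zs δ M) {C μ σ q : ℝ} {r : ℕ} (hr : r < m)
    {z dz : PDVec n m} {T : Finset (Fin m)} (hs : P.IsFirstStep zs δ C r μ σ z dz T)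
    (hq : orderedPairSize dz ⟨r, hr⟩ ≤ q) {v w : PDVec n m}
    (hw : P.jac (z + dz) *ᵥ w.ofLp = P.modJac z dz T *ᵥ v.ofLp) :
    ‖v - w‖ ≤ M * q * ‖v‖ := by
  have hJ := h.2.2 _ hs.next_mem_ball
  have hq0 : 0 ≤ q := (Real.sqrt_nonneg _).trans hq
  have h1 := P.jac_add_mulVec z dz v T
  rw [← hw] at h1
  have h2 : P.jac (z + dz) *ᵥ (v - w).ofLp = (slackEmb (fun i =>
      if i ∈ T then 0 else slack dz i * mult v i + mult dz i * slack v i) : PDVec n m).ofLp := by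
    rw [WithLp.ofLp_sub, Matrix.mulVec_sub, h1, add_sub_cancel_left]
  have h3 := norm_le_of_mulVec_eq hJ.1 hJ.2 h2
  refine h3.trans ?_
  rw [mul_assoc]
  refine mul_le_mul_of_nonneg_left (norm_slackEmb_le v _ hq0 fun i => ?_) h.2.1.le
  have hv : 0 ≤ pairSize v i := Real.sqrt_nonneg _
  split_ifs with hi
  · rw [abs_zero]; positivity
  · refine (abs_cross_le dz v i).trans (mul_le_mul_of_nonneg_right ?_ hv)
    exact (pairSize_le_orderedPairSize hr hs.largest hi).trans hq

/-- A kernel vector `v` satisfies the perturbation bound with `w = 0`, so `‖v‖ ≤ M q ‖v‖`, which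
forces `v = 0`. -/
theorem QP.IsFirstStep.isUnit_modJac (h : P.IsJacNhd zs δ M) {C μ σ q : ℝ} {r : ℕ} (hr : r < m)
    {z dz : PDVec n m} {T : Finset (Fin m)} (hs : P.IsFirstStep zs δ C r μ σ z dz T)
    (hq : orderedPairSize dz ⟨r, hr⟩ ≤ q) (hMq : M * q < 1) : IsUnit (P.modJac z dz T) := by
  rw [← Matrix.mulVec_injective_iff_isUnit]
  refine (injective_iff_map_eq_zero (P.modJac z dz T).mulVecLin).2 fun v hv => ?_
  have h1 : P.jac (z + dz) *ᵥ (0 : PDVec n m).ofLp =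
      P.modJac z dz T *ᵥ (WithLp.toLp 2 v : PDVec n m).ofLp := by
    simpa using hv.symm
  have h2 := hs.norm_le_of_jac_eq h hr hq h1
  rw [sub_zero] at h2
  have h3 : ‖(WithLp.toLp 2 v : PDVec n m)‖ = 0 := by
    nlinarith [norm_nonneg (WithLp.toLp 2 v : PDVec n m)]
  simpa using h3

/-- Both steps have the same right-hand side, so the perturbation bound applies; its factor `‖dzM‖`
is traded for `‖dzN‖` by the triangle inequality and absorption. -/
theorem QP.IsFirstStep.norm_newton_sub_modNewton_le (h : P.IsJacNhd zs δ M) {C μ σ ν q : ℝ} {r : ℕ}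
    (hr : r < m) {z dz dzN dzM : PDVec n m} {T : Finset (Fin m)}
    (hs : P.IsFirstStep zs δ C r μ σ z dz T) (hq : orderedPairSize dz ⟨r, hr⟩ ≤ q)
    (hMq : M * q < 1) (hN : P.IsNewtonStep ν (z + dz) dzN)
    (hM : P.IsModNewtonStep ν z dz T dzM) :
    ‖dzN - dzM‖ ≤ M * q / (1 - M * q) * ‖dzN‖ := by
  have h1 := hs.norm_le_of_jac_eq h hr hq (v := dzM) (w := dzN) (hN.trans hM.symm)
  have hq0 : 0 ≤ M * q := mul_nonneg h.2.1.le ((Real.sqrt_nonneg _).trans hq)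
  have h2 : ‖dzM‖ ≤ ‖dzM - dzN‖ + ‖dzN‖ := by simpa using norm_add_le (dzM - dzN) dzN
  rw [norm_sub_rev, div_mul_eq_mul_div, le_div_iff₀ (by linarith)]
  nlinarith [mul_le_mul_of_nonneg_left h2 hq0]

end Estimates

/-! ### Existence of the ball and of the barrier trajectory. -/

/-- For a kernel vector `(p, λ, s)`, strict complementarity makes `s` vanish on active and `λ` on
inactive constraints. Then `pᵀHp = (Ap)ᵀλ = sᵀλ = 0`, so `p = 0` by the curvature condition, and
`Aᵀλ = 0` gives `λ = 0` by independence of the active rows. -/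
theorem QP.IsStrictMin.isUnit_jac {P : QP n m} {zs : PDVec n m} (hzs : P.IsStrictMin zs)
    (hli : P.LICQ zs) : IsUnit (P.jac zs) := by
  rw [← Matrix.mulVec_injective_iff_isUnit]
  refine (injective_iff_map_eq_zero (P.jac zs).mulVecLin).2 fun v' hv => ?_
  obtain ⟨v, rfl⟩ : ∃ v : PDVec n m, v.ofLp = v' := ⟨WithLp.toLp 2 v', rfl⟩
  rw [Matrix.mulVecLin_apply, P.jac_mulVec] at hv
  have h1 : P.H *ᵥ primal v = P.Aᵀ *ᵥ mult v := by
    funext j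
    simpa [sub_eq_zero] using congrFun hv (ix j)
  have h2 : P.A *ᵥ primal v = slack v := by
    funext i
    simpa [sub_eq_zero] using congrFun hv (il i)
  have h3 : ∀ i, slack zs i * mult v i + mult zs i * slack v i = 0 := fun i => by
    simpa using congrFun hv (is i)
  have hact : ∀ i, slack zs i = 0 → slack v i = 0 := fun i hi => by
    have hs := hzs.strict i
    have := h3 i
    rw [hi] at hs this
    have hne : mult zs i ≠ 0 := by linarith
    simpa [hne] using this
  have hina : ∀ i, slack zs i ≠ 0 → mult v i = 0 := fun i hi => by
    have h0 : mult zs i = 0 := (mul_eq_zero.1 (hzs.complementarity i)).resolve_left hi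
    have := h3 i
    rw [h0] at this
    simpa [hi] using this
  have hprim : primal v = 0 := by
    by_contra hne
    have hpos := hzs.posDef (primal v) hne fun i hi _ => by rw [h2, hact i hi]
    rw [h1, Matrix.mulVec_transpose, ← dotProduct_comm, ← Matrix.dotProduct_mulVec, h2] at hpos
    refine hpos.ne' (Finset.sum_eq_zero fun i _ => ?_)
    by_cases hi : slack zs i = 0
    · rw [hact i hi, mul_zero]
    · rw [hina i hi, zero_mul]
  have hslack : slack v = 0 := by rw [← h2, hprim, Matrix.mulVec_zero]
  have hmult : mult v = 0 := by
    rw [hprim, Matrix.mulVec_zero, Matrix.mulVec_transpose, Matrix.vecMul_eq_sum] at h1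
    have hsum : ∑ i : {i : Fin m // slack zs i = 0}, mult v i • P.A (i : Fin m) = 0 := by
      refine Eq.trans ?_ h1.symm
      rw [← Finset.sum_subtype (Finset.univ.filter fun i => slack zs i = 0) (by simp)
        (fun i => mult v i • P.A i)]
      refine Finset.sum_filter_of_ne fun i _ hne => ?_
      by_contra hi
      exact hne (by rw [hina i hi, zero_smul])
    have hz := Fintype.linearIndependent_iff.1 hli (fun i => mult v i) hsum
    funext i
    by_cases hi : slack zs i = 0
    · exact hz ⟨i, hi⟩
    · exact hina i hi
  funext k
  rcases k with j | i | i
  · exact congrFun hprim j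
  · exact congrFun hmult i
  · exact congrFun hslack i

theorem continuous_mult : Continuous (mult : PDVec n m → Fin m → ℝ) := by
  unfold mult; fun_prop

theorem continuous_slack : Continuous (slack : PDVec n m → Fin m → ℝ) := by
  unfold slack; fun_prop

theorem QP.continuous_jac (P : QP n m) : Continuous P.jac :=
  continuous_const.matrix_fromBlocks continuous_const continuous_const
    (continuous_const.matrix_fromBlocks continuous_const continuous_slack.matrix_diagonal
      continuous_mult.matrix_diagonal)

theorem QP.exists_isJacNhd (P : QP n m) {zs : PDVec n m} (h : IsUnit (P.jac zs)) :
    ∃ δ M : ℝ, P.IsJacNhd zs δ M := by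
  have hinv : ContinuousAt (fun z => ‖(P.jac z)⁻¹‖) zs := by
    simp only [Matrix.nonsing_inv_eq_ringInverse]
    obtain ⟨u, hu⟩ := h
    have := NormedRing.inverse_continuousAt u
    rw [hu] at this
    exact (ContinuousAt.comp (f := P.jac) this P.continuous_jac.continuousAt).norm
  have hunit : ∀ᶠ z in 𝓝 zs, IsUnit (P.jac z) :=
    P.continuous_jac.continuousAt.eventually (Units.isOpen.mem_nhds h)
  have hbd := hinv.eventually (gt_mem_nhds (lt_add_one _))
  obtain ⟨δ, hδ, hball⟩ := Metric.eventually_nhds_iff_ball.1 (hunit.and hbd)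
  exact ⟨δ, ‖(P.jac zs)⁻¹‖ + 1, hδ, by positivity, fun z hz =>
    ⟨(hball z hz).1, (hball z hz).2.le⟩⟩

theorem QP.contDiff_residual (P : QP n m) (μ : ℝ) : ContDiff ℝ 1 (P.residual μ) := by
  rw [contDiff_euclidean]
  rintro (j | i | i) <;>
    simp only [QP.residual, primal, mult, slack, Matrix.mulVec, dotProduct, Sum.elim_inl,
      Sum.elim_inr, Pi.add_apply, Pi.sub_apply] <;> fun_prop

theorem QP.hasFDerivAt_residual (P : QP n m) (μ : ℝ) (z : PDVec n m) :
    HasFDerivAt (P.residual μ) (Matrix.toEuclideanCLM (𝕜 := ℝ) (P.jac z)) z := by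
  rw [hasFDerivAt_iff_isLittleO_nhds_zero]
  refine Asymptotics.IsBigO.trans_isLittleO (g := fun d : PDVec n m => ‖d‖ ^ 2) ?_
    (Asymptotics.isLittleO_norm_pow_id one_lt_two)
  refine Asymptotics.IsBigO.of_bound 1 (Eventually.of_forall fun d => ?_)
  have h : P.residual μ (z + d) - P.residual μ z - Matrix.toEuclideanCLM (𝕜 := ℝ) (P.jac z) d =
      slackEmb (fun i => mult d i * slack d i) := by
    rw [P.residual_add, show Matrix.toEuclideanCLM (𝕜 := ℝ) (P.jac z) d =
      WithLp.toLp 2 (P.jac z *ᵥ d.ofLp) from rfl]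
    abel
  rw [h, one_mul, norm_pow, norm_norm, sq]
  exact norm_slackEmb_le d _ (norm_nonneg _) (abs_mult_mul_slack_le d)

theorem QP.IsStrictMin.residual_zero {P : QP n m} {zs : PDVec n m} (hzs : P.IsStrictMin zs) :
    P.residual 0 zs = 0 := by
  ext k
  rcases k with j | i | i
  · simpa [QP.residual] using congrFun hzs.stationarity j
  · simpa [QP.residual] using congrFun hzs.feasibility i
  · simpa [QP.residual, mul_comm] using hzs.complementarity i

/-- `F_μ(z) = 0` means `F_0(z) = μ(0, 0, e)`, so the trajectory is a local inverse of `F_0` at `z*`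
evaluated along a ray; it is Lipschitz because the local inverse is strictly differentiable. -/
theorem QP.IsStrictMin.exists_isTrajectory {P : QP n m} {zs : PDVec n m} (hzs : P.IsStrictMin zs)
    (hu : IsUnit (P.jac zs)) {δ : ℝ} (hδ : 0 < δ) :
    ∃ (μhat : ℝ) (zμ : ℝ → PDVec n m), P.IsTrajectory zs δ μhat zμ := by
  have hu' : IsUnit (Matrix.toEuclideanCLM (𝕜 := ℝ) (P.jac zs)) := hu.map _
  obtain ⟨u, hu'⟩ := hu'
  let f' : PDVec n m ≃L[ℝ] PDVec n m := ContinuousLinearEquiv.unitsEquiv ℝ _ u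
  have hstrict : HasStrictFDerivAt (P.residual 0) (f' : PDVec n m →L[ℝ] PDVec n m) zs := by
    refine (P.contDiff_residual 0).contDiffAt.hasStrictFDerivAt' ?_ one_ne_zero
    have : (f' : PDVec n m →L[ℝ] PDVec n m) = u := by ext; rfl
    rw [this, hu']
    exact P.hasFDerivAt_residual 0 zs
  have hloc := hstrict.to_localInverse
  rw [hzs.residual_zero] at hloc
  obtain ⟨L, t, ht, hL⟩ := hloc.exists_lipschitzOnWith
  have hright := hstrict.eventually_right_inverse
  have htend := hstrict.localInverse_continuousAt
  have him := hstrict.localInverse_apply_image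
  rw [hzs.residual_zero] at hright htend him
  have hball := htend.eventually (Metric.ball_mem_nhds _ hδ)
  rw [him] at hball
  let p : ℝ →  PDVec n m := fun μ => -(μ • residualDeriv n m)
  have hp : LipschitzWith ‖residualDeriv n m‖₊ p := by
    refine LipschitzWith.of_dist_le_mul fun x y => ?_
    simp only [p, dist_eq_norm, coe_nnnorm]
    rw [← neg_sub', ← sub_smul, norm_neg, norm_smul, mul_comm]
  have hp0 : Tendsto p (𝓝 0) (𝓝 0) := by
    have := hp.continuous.tendsto 0
    simpa [p] using this
  have hev := hp0.eventually ((Filter.Eventually.and ht hball).and hright)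
  obtain ⟨ε, hε, hev⟩ := Metric.eventually_nhds_iff_ball.1 hev
  have hmem : ∀ μ ∈ Set.Ioc 0 (ε / 2), μ ∈ Metric.ball (0 : ℝ) ε := fun μ hμ => by
    rw [Metric.mem_ball, Real.dist_0_eq_abs, abs_of_pos hμ.1]
    linarith [hμ.2]
  refine ⟨ε / 2, hstrict.localInverse _ _ _ ∘ p, half_pos hε,
    ⟨_, hL.comp hp.lipschitzOnWith fun μ hμ => (hev μ (hmem μ hμ)).1.1⟩, fun μ hμ => ?_⟩
  obtain ⟨⟨_, h1⟩, h2⟩ := hev μ (hmem μ hμ)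
  refine ⟨h1, ?_⟩
  rw [P.residual_eq_add_smul μ 0, Function.comp_apply, h2]
  simp [p]

end QPBarrier

/-! ### Choice of the constants. -/

theorem mainTheorem2 {n m : ℕ} (P : QPBarrier.QP n m) (zs : QPBarrier.PDVec n m)
    (hzs : P.IsStrictMin zs) :
    (P.LICQ zs → ∃ δ M : ℝ, P.IsJacNhd zs δ M) ∧
    ∀ δ M : ℝ, P.IsJacNhd zs δ M →
      (∃ (μhat : ℝ) (zμ : ℝ → QPBarrier.PDVec n m), P.IsTrajectory zs δ μhat zμ) ∧
      ∀ (μhat : ℝ) (zμ : ℝ → QPBarrier.PDVec n m), P.IsTrajectory zs δ μhat zμ →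
      ∀ (r : ℕ) (hr : r < m) (C : ℝ), 0 < C →
        -- a constant `Cr` that bounds the `(r+1)`-st largest pair exists
        (∃ Cr : ℝ, 0 < Cr ∧
          ∀ μ ∈ Set.Ioc 0 μhat, ∀ σ ∈ Set.Ioo (0 : ℝ) 1,
          ∀ (z dz : QPBarrier.PDVec n m) (T : Finset (Fin m)),
            P.IsFirstStep zs δ C r μ σ z dz T →
            QPBarrier.orderedPairSize dz ⟨r, hr⟩ ≤ Cr * μ) ∧
        -- the error bound; `K` is the constant of the `O(μ ^ 3)` term
        (∃ K : ℝ, 0 < K ∧ ∀ Cr : ℝ, 0 < Cr →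
          ∃ μbar ∈ Set.Ioc 0 μhat,
          ∀ μ ∈ Set.Ioc 0 μbar, ∀ σ ∈ Set.Ioo (0 : ℝ) 1, ∀ σ' ∈ Set.Ioc (0 : ℝ) 1,
          ∀ (z dz : QPBarrier.PDVec n m) (T : Finset (Fin m)),
            P.IsFirstStep zs δ C r μ σ z dz T →
            QPBarrier.orderedPairSize dz ⟨r, hr⟩ ≤ Cr * μ →
            M * Cr * μ < 1 ∧ IsUnit (P.modJac z dz T) ∧
            ∀ dzN dzM : QPBarrier.PDVec n m,
              P.IsNewtonStep (σ' * (σ * μ)) (z + dz) dzN →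
              P.IsModNewtonStep (σ' * (σ * μ)) z dz T dzM →
              ‖dzN - dzM‖ ≤ M * Cr / (1 - M * Cr * μ) *
                (P.trajConst zs δ * (1 - σ') * σ * μ ^ 2 + K * μ ^ 3)) ∧
        -- the error is `O(μ ^ 2)`, and `O(μ ^ 3)` if the barrier parameter is kept
        (∃ K : ℝ, 0 < K ∧ ∃ μbar ∈ Set.Ioc 0 μhat,
          ∀ μ ∈ Set.Ioc 0 μbar, ∀ σ ∈ Set.Ioo (0 : ℝ) 1, ∀ σ' ∈ Set.Ioc (0 : ℝ) 1,
          ∀ (z dz : QPBarrier.PDVec n m) (T : Finset (Fin m)),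
            P.IsFirstStep zs δ C r μ σ z dz T →
            ∀ dzN dzM : QPBarrier.PDVec n m,
              P.IsNewtonStep (σ' * (σ * μ)) (z + dz) dzN →
              P.IsModNewtonStep (σ' * (σ * μ)) z dz T dzM →
              ‖dzN - dzM‖ ≤ K * μ ^ 2 ∧ (σ' = 1 → ‖dzN - dzM‖ ≤ K * μ ^ 3)) := by
  -- For the trajectory, nonsingularity at `zs` is read off from the ball itself, not from `LICQ`.
  refine ⟨fun hli => P.exists_isJacNhd (hzs.isUnit_jac hli), fun δ M hJ =>
    ⟨hzs.exists_isTrajectory (hJ.2.2 zs (Metric.mem_ball_self hJ.1)).1 hJ.1,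
      fun μhat zμ htraj r hr C hC => ?_⟩⟩
  have hμhat : 0 < μhat := htraj.1
  have hM : 0 < M := hJ.2.1
  have hC3 := P.trajConst_nonneg zs δ
  set C3 := P.trajConst zs δ
  have hCr0 : 0 < M * (C + √m) := by positivity
  set Cs := M * (C + √m)
  have hK0 : 0 < M * Cs ^ 2 := by positivity
  set K := M * Cs ^ 2
  have hpair : ∀ μ σ : ℝ, 0 < μ → σ ∈ Set.Ioo (0 : ℝ) 1 → ∀ (z dz : QPBarrier.PDVec n m)
      (T : Finset (Fin m)), P.IsFirstStep zs δ C r μ σ z dz T →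
      QPBarrier.orderedPairSize dz ⟨r, hr⟩ ≤ Cs * μ := fun μ σ hμ hσ z dz T hs =>
    (QPBarrier.pairSize_le_norm dz _).trans (hs.norm_le hJ hμ hσ)
  have herr : ∀ Cr : ℝ, 0 < Cr → ∀ μ σ σ' : ℝ, 0 < μ → M * Cr * μ < 1 →
      σ ∈ Set.Ioo (0 : ℝ) 1 → σ' ∈ Set.Ioc (0 : ℝ) 1 → ∀ (z dz : QPBarrier.PDVec n m)
      (T : Finset (Fin m)), P.IsFirstStep zs δ C r μ σ z dz T →
      QPBarrier.orderedPairSize dz ⟨r, hr⟩ ≤ Cr * μ → ∀ dzN dzM : QPBarrier.PDVec n m,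
      P.IsNewtonStep (σ' * (σ * μ)) (z + dz) dzN →
      P.IsModNewtonStep (σ' * (σ * μ)) z dz T dzM →
      ‖dzN - dzM‖ ≤ M * Cr / (1 - M * Cr * μ) *
        (C3 * (1 - σ') * σ * μ ^ 2 + K * μ ^ 3) := by
    intro Cr hCr μ σ σ' hμ hlt hσ hσ' z dz T hs hq dzN dzM hN hMod
    have h1 := hs.norm_newton_sub_modNewton_le hJ hr hq (by rwa [← mul_assoc]) hN hMod
    have h2 := hs.norm_nextNewton_le hJ hμ hσ hσ' hN
    have h3 : 0 < 1 - M * (Cr * μ) := by rw [← mul_assoc]; linarith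
    calc ‖dzN - dzM‖ ≤ M * (Cr * μ) / (1 - M * (Cr * μ)) * ‖dzN‖ := h1
      _ ≤ M * (Cr * μ) / (1 - M * (Cr * μ)) * (C3 * (1 - σ') * σ * μ + K * μ ^ 2) := by gcongr
      _ = _ := by rw [← mul_assoc M]; ring
  -- This threshold gives `M * Cr * μ ≤ 1 / 2`, so that `1 / (1 - M * Cr * μ) ≤ 2`.
  have hμbar : ∀ Cr : ℝ, 0 < Cr → min μhat (1 / (2 * (M * Cr))) ∈ Set.Ioc 0 μhat :=
    fun Cr hCr => ⟨lt_min hμhat (by positivity), min_le_left _ _⟩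
  have hsmall : ∀ Cr : ℝ, 0 < Cr → ∀ μ ∈ Set.Ioc 0 (min μhat (1 / (2 * (M * Cr)))),
      M * Cr * μ ≤ 1 / 2 := by
    intro Cr hCr μ hμ
    have h := hμ.2.trans (min_le_right _ _)
    rw [le_div_iff₀ (by positivity)] at h
    linarith
  -- In the last constant, `K * μhat` absorbs `K * μ ^ 3` into order `μ ^ 2`; the extra `K` keeps it
  -- positive and lets it serve the case `σ' = 1` too.
  refine ⟨⟨Cs, hCr0, fun μ hμ σ hσ => hpair μ σ hμ.1 hσ⟩, ⟨K, hK0, fun Cr hCr =>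
    ⟨_, hμbar Cr hCr, fun μ hμ σ hσ σ' hσ' z dz T hs hq => ?_⟩⟩,
    ⟨2 * (M * Cs) * (C3 + K * μhat + K), by positivity, _, hμbar Cs hCr0,
      fun μ hμ σ hσ σ' hσ' z dz T hs dzN dzM hN hMod => ?_⟩⟩
  · have hlt : M * Cr * μ < 1 := (hsmall Cr hCr μ hμ).trans_lt (by norm_num)
    exact ⟨hlt, hs.isUnit_modJac hJ hr hq (by rwa [← mul_assoc]),
      herr Cr hCr μ σ σ' hμ.1 hlt hσ hσ' z dz T hs hq⟩
  · have hle := hsmall Cs hCr0 μ hμ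
    have hμ0 := hμ.1
    have hμle : μ ≤ μhat := hμ.2.trans (min_le_left _ _)
    have h1 := herr Cs hCr0 μ σ σ' hμ0 (hle.trans_lt (by norm_num)) hσ hσ' z dz T hs
      (hpair μ σ hμ0 hσ z dz T hs) dzN dzM hN hMod
    have hfac : M * Cs / (1 - M * Cs * μ) ≤ 2 * (M * Cs) := by
      rw [div_le_iff₀ (by linarith)]
      nlinarith [mul_pos hM hCr0]
    have hσ1 : 0 ≤ 1 - σ' := sub_nonneg.2 hσ'.2
    have hσ0 := hσ.1
    have h2 : ‖dzN - dzM‖ ≤ 2 * (M * Cs) * (C3 * (1 - σ') * σ * μ ^ 2 + K * μ ^ 3) :=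
      h1.trans (mul_le_mul_of_nonneg_right hfac (by positivity))
    have hσσ : (1 - σ') * σ ≤ 1 :=
      mul_le_one₀ (by linarith [hσ'.1]) hσ0.le hσ.2.le
    refine ⟨h2.trans ?_, fun h => h2.trans ?_⟩
    · have h3 : C3 * (1 - σ') * σ * μ ^ 2 + K * μ ^ 3 ≤ (C3 + K * μhat + K) * μ ^ 2 := by
        have h4 : C3 * ((1 - σ') * σ) ≤ C3 := mul_le_of_le_one_right hC3 hσσ
        have h5 : K * μ ≤ K * μhat := by gcongr
        calc _ = (C3 * ((1 - σ') * σ) + K * μ) * μ ^ 2 := by ring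
          _ ≤ _ := mul_le_mul_of_nonneg_right (by linarith) (sq_nonneg μ)
      calc _ ≤ 2 * (M * Cs) * ((C3 + K * μhat + K) * μ ^ 2) :=
            mul_le_mul_of_nonneg_left h3 (by positivity)
        _ = _ := by ring
    · have h3 : K * μ ^ 3 ≤ (C3 + K * μhat + K) * μ ^ 3 := by
        have : 0 ≤ C3 + K * μhat := by positivity
        exact mul_le_mul_of_nonneg_right (by linarith) (by positivity)
      rw [h, sub_self, mul_zero, zero_mul, zero_mul, zero_add]
      calc _ ≤ 2 * (M * Cs) * ((C3 + K * μhat + K) * μ ^ 3) :=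
            mul_le_mul_of_nonneg_left h3 (by positivity)
        _ = _ := by ring
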